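/- Let $n\ge 1$ and $r\ge 0$ be integers. Let $\mathbf X_1,\dots,\mathbf X_r$ be the generic $n\times n$ matrices, whose entries are the $rn^2$ coordinate functions on $\mathfrak{gl}(n,\mathbb C)^{\times r}$. Let $\mathbb C[\mathfrak Y_r]=\mathbb C[\mathfrak{gl}(n,\mathbb C)^{\times r}]^{\mathrm{GL}(n,\mathbb C)}$ be the algebra of polynomials on $\mathfrak{gl}(n,\mathbb C)^{\times r}$ invariant under simultaneous conjugation by $\mathrm{GL}(n,\mathbb C)$, let $\mathbb C[\mathfrak X_r]=\mathbb C[\mathrm{SL}(n,\mathbb C)^{\times r}]^{\mathrm{SL}(n,\mathbb C)}$ be the algebra of regular functions on $\mathrm{SL}(n,\mathbb C)^{\times r}$ invariant under simultaneous conjugation by $\mathrm{SL}(n,\mathbb C)$, and let $\Pi:\mathbb C[\mathfrak Y_r]\to\mathbb C[\mathfrak X_r]$ be the restriction of functions. A generating set of the $\mathbb C$-algebra $\mathbb C[\mathfrak Y_r]$ is called a set of Procesi generators if each of its elements is the trace $\mathrm{tr}(\mathbf W)$ of a word $\mathbf W$ in $\mathbf X_1,\dots,\mathbf X_r$, and none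 of its elements has the form $\mathrm{tr}(\mathbf W_1\mathbf X_k^n\mathbf W_2)$ with $1\le k\le r$ and words $\mathbf W_1,\mathbf W_2$ that are not both empty. A generating set is minimal if no proper subset of it generates. Let $\mathcal G$ be a minimal set of Procesi generators of $\mathbb C[\mathfrak Y_r]$. Then $\Pi\left(\mathcal G\setminus\{\mathrm{tr}(\mathbf X_1^n),\dots,\mathrm{tr}(\mathbf X_r^n)\}\right)$ is a minimal generating set of the $\mathbb C$-algebra $\mathbb C[\mathfrak X_r]$, and it has exactly $r$ elements fewer than $\mathcal G$. Moreover, both sets have the least possible cardinality among generating sets of $\mathbb C[\mathfrak X_r]$ and $\mathbb C[\mathfrak Y_r]$, respectively. In particular, if $N(R)$ denotes the least number of generators of a $\mathbb C$-algebra $R$, then $N(\mathbb C[\mathfrak X_r])+r=N(\mathbb C[\mathfrak Y_r])$. -/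

import Mathlib

open scoped MatrixGroups

namespace TraceInv

/-- `ℂ[gl(n)^r]`: the polynomial ring in the entries `x^k_{ij}`, indexed by `(k, i, j)`. -/
abbrev PolyRing (n r : ℕ) : Type := MvPolynomial (Fin r × Fin n × Fin n) ℂ

/-- Evaluation of a polynomial at an `r`-tuple of complex `n × n` matrices. -/
noncomputable def evalAt {n r : ℕ} (A : Fin r → Matrix (Fin n) (Fin n) ℂ) :
    PolyRing n r →ₐ[ℂ] ℂ :=
  MvPolynomial.aeval fun x => A x.1 x.2.1 x.2.2

/-- The `k`-th generic matrix. -/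
noncomputable def genericMatrix (n r : ℕ) (k : Fin r) :
    Matrix (Fin n) (Fin n) (PolyRing n r) :=
  Matrix.of fun i j => MvPolynomial.X (k, i, j)

/-- The trace of a word in the generic matrices. -/
noncomputable def traceWord (n : ℕ) {r : ℕ} (w : List (Fin r)) : PolyRing n r :=
  (w.map (genericMatrix n r)).prod.trace

/-- `ℂ[gl(n)^r // GL(n)]`: the polynomials on `gl(n)^r` that are invariant under simultaneous
conjugation by `GL(n, ℂ)`. -/
noncomputable def invGL (n r : ℕ) : Subalgebra ℂ (PolyRing n r) where
  carrier := {p | ∀ (g : GL (Fin n) ℂ) (A : Fin r → Matrix (Fin n) (Fin n) ℂ),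
    evalAt (fun k => (g : Matrix (Fin n) (Fin n) ℂ) * A k *
      ((g⁻¹ : GL (Fin n) ℂ) : Matrix (Fin n) (Fin n) ℂ)) p = evalAt A p}
  mul_mem' hp hq g A := by rw [map_mul, map_mul, hp g A, hq g A]
  add_mem' hp hq g A := by rw [map_add, map_add, hp g A, hq g A]
  algebraMap_mem' c g A := by rw [AlgHom.commutes, AlgHom.commutes]

/-- Restriction of a polynomial on `gl(n)^r` to a function on `SL(n)^r`. -/
noncomputable def restrictSL (n r : ℕ) :
    PolyRing n r →ₐ[ℂ] ((Fin r → SL(n, ℂ)) → ℂ) :=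
  AlgHom.pi fun A => evalAt fun k => (A k : Matrix (Fin n) (Fin n) ℂ)

/-- `ℂ[SL(n)^r // SL(n)]`: the regular functions on the affine variety `SL(n)^r` (restrictions of
polynomials in the matrix entries) that are invariant under simultaneous conjugation by
`SL(n, ℂ)`. -/
noncomputable def invSL (n r : ℕ) : Subalgebra ℂ ((Fin r → SL(n, ℂ)) → ℂ) where
  carrier := {f | f ∈ (restrictSL n r).range ∧
    ∀ (g : SL(n, ℂ)) (A : Fin r → SL(n, ℂ)), f (fun k => g * A k * g⁻¹) = f A}
  mul_mem' hp hq := ⟨mul_mem hp.1 hq.1, fun g A => by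
    rw [Pi.mul_apply, Pi.mul_apply, hp.2 g A, hq.2 g A]⟩
  add_mem' hp hq := ⟨add_mem hp.1 hq.1, fun g A => by
    rw [Pi.add_apply, Pi.add_apply, hp.2 g A, hq.2 g A]⟩
  algebraMap_mem' c := ⟨Subalgebra.algebraMap_mem _ c, fun _ _ => rfl⟩

theorem restrictSL_mem {n r : ℕ} (p : invGL n r) :
    restrictSL n r (p : PolyRing n r) ∈ invSL n r := by
  refine ⟨⟨_, rfl⟩, fun g A => ?_⟩
  have h := p.2 (g : GL (Fin n) ℂ) (fun k => (A k : Matrix (Fin n) (Fin n) ℂ))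
  rw [← map_inv] at h
  change evalAt (fun k => ((g * A k * g⁻¹ : SL(n, ℂ)) : Matrix (Fin n) (Fin n) ℂ)) p.1 =
    evalAt (fun k => (A k : Matrix (Fin n) (Fin n) ℂ)) p.1
  rw [← h]
  congr 2

/-- The projection `ℂ[gl(n)^r // GL(n)] → ℂ[SL(n)^r // SL(n)]`, restriction of functions. -/
noncomputable def proj (n r : ℕ) : invGL n r →ₐ[ℂ] invSL n r :=
  ((restrictSL n r).comp (invGL n r).val).codRestrict (invSL n r) restrictSL_mem

theorem evalAt_traceWord {n r : ℕ} (A : Fin r → Matrix (Fin n) (Fin n) ℂ) (w : List (Fin r)) :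
    evalAt A (traceWord n w) = (w.map A).prod.trace := by
  have h : ∀ k, (evalAt A).mapMatrix (genericMatrix n r k) = A k := fun k => by
    ext i j; simp [genericMatrix, evalAt]
  have h2 : (evalAt A).mapMatrix (w.map (genericMatrix n r)).prod = (w.map A).prod := by
    rw [map_list_prod, List.map_map]
    congr 1
    exact List.map_congr_left fun k _ => h k
  rw [← h2, traceWord, Matrix.trace, Matrix.trace, map_sum]
  rfl

theorem traceWord_mem (n : ℕ) {r : ℕ} (w : List (Fin r)) : traceWord n w ∈ invGL n r := by
  intro g A
  rw [evalAt_traceWord, evalAt_traceWord]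
  have h : (w.map fun k => (g : Matrix (Fin n) (Fin n) ℂ) * A k *
      ((g⁻¹ : GL (Fin n) ℂ) : Matrix (Fin n) (Fin n) ℂ)).prod =
      (g : Matrix (Fin n) (Fin n) ℂ) * (w.map A).prod *
      ((g⁻¹ : GL (Fin n) ℂ) : Matrix (Fin n) (Fin n) ℂ) := by
    induction w with
    | nil => simp
    | cons k w ih =>
      rw [List.map_cons, List.prod_cons, ih, List.map_cons, List.prod_cons]
      simp only [mul_assoc]
      rw [Units.inv_mul_cancel_left]
  rw [h, Matrix.trace_mul_cycle, Units.inv_mul, one_mul]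

/-- The trace of a word as an element of `ℂ[gl(n)^r // GL(n)]`. -/
noncomputable def traceInv (n : ℕ) {r : ℕ} (w : List (Fin r)) : invGL n r :=
  ⟨traceWord n w, traceWord_mem n w⟩

/-- The set `{tr(X_1^n), …, tr(X_r^n)}`. -/
def powerTraces (n r : ℕ) : Set (invGL n r) :=
  Set.range fun k : Fin r => traceInv n (List.replicate n k)

/-- `S` generates the `ℂ`-algebra `R`, and no proper subset of `S` does. -/
def IsMinimalGenerating {R : Type*} [CommRing R] [Algebra ℂ R] (S : Set R) : Prop :=
  Minimal (fun T : Set R => Algebra.adjoin ℂ T = ⊤) S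

/-- The least cardinality of a generating set of the `ℂ`-algebra `R` (`⊤` if `R` is not finitely
generated). -/
noncomputable def minNumGenerators (R : Type*) [CommRing R] [Algebra ℂ R] : ℕ∞ :=
  ⨅ T ∈ {T : Set R | Algebra.adjoin ℂ T = ⊤}, T.encard

/-- Procesi generators: a generating set consisting of traces of words in the generic matrices,
none of which has the form `tr(W₁ X_k^n W₂)` with `W₁` or `W₂` a nonempty word. -/
structure IsProcesiGenerators {n r : ℕ} (S : Set (invGL n r)) : Prop where
  adjoin_eq_top : Algebra.adjoin ℂ S = ⊤
  isTrace : ∀ s ∈ S, ∃ w : List (Fin r), s = traceInv n w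
  no_power : ∀ s ∈ S, ∀ (k : Fin r) (w₁ w₂ : List (Fin r)), (w₁ ≠ [] ∨ w₂ ≠ []) →
    s ≠ traceInv n (w₁ ++ List.replicate n k ++ w₂)

end TraceInv

/-!
Let `d` denote the differential at the origin. By Nakayama's lemma for graded algebras, a set of
homogeneous invariants is a minimal generating set exactly when its image under `d` is a basis of
the cotangent space at the origin.

Let `D` be the permutation matrix of an `n`-cycle. It is conjugate to `ζ • D` for a primitive
`n`-th root of unity `ζ`, so invariants of degree strictly between `0` and `n` vanish on the tuple
with `D` in the `k`-th slot and zeros elsewhere. Taking the value of the component of degree `n`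
there hence kills products and gives a functional on the cotangent space. The functional vanishes
on `tr W` unless `W = X_k ^ n`, but not on `det X_k`. In a minimal set of trace generators one may
therefore replace the elements `tr (X_k ^ n)` by the determinants `det X_k`, and all of these occur.

The translation `X ↦ X + 1` does not change the leading forms of homogeneous invariants, so the
differentials of these generators are still independent at the tuple of identity matrices.
Restriction to `SL(n)^r` is surjective, and its kernel is generated by the `det X_k - 1`: components
whose multidegrees are congruent modulo `n` are homogenized by powers of the determinants, and
scaling by `n`-th roots of unity separates the congruence classes. The kernel thus cuts exactly the
span of the differentials of the `det X_k` out of the cotangent space at the identity, and the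
remaining generators stay independent.
-/

namespace TraceInv

section Differential

variable {K R R' : Type*} [Field K] [CommRing R] [Algebra K R] [CommRing R'] [Algebra K R']

/-- The differential at a `K`-rational point of `Spec R`, given as an algebra homomorphism
`ε : R → K` with kernel `𝔪`: it sends `x` to the class of `x - ε x` in the Zariski cotangent space
`𝔪 / 𝔪²`. -/
def differential (ε : R →ₐ[K] K) : R →ₗ[K] (RingHom.ker ε).Cotangent :=
  (RingHom.ker ε).toCotangent.restrictScalars K ∘ₗ
    (LinearMap.id - Algebra.linearMap K R ∘ₗ ε.toLinearMap).codRestrict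
      ((RingHom.ker ε).restrictScalars K) fun x => by simp

variable (ε : R →ₐ[K] K)

theorem differential_eq_zero_iff {x : R} :
    differential ε x = 0 ↔ x - algebraMap K R (ε x) ∈ RingHom.ker ε ^ 2 :=
  (RingHom.ker ε).toCotangent_eq_zero _

theorem differential_eq_zero_of_mem {x : R} (hx : x ∈ RingHom.ker ε ^ 2) :
    differential ε x = 0 := by
  have hεx : ε x = 0 := Ideal.pow_le_self two_ne_zero hx
  rwa [differential_eq_zero_iff, hεx, map_zero, sub_zero]

theorem differential_algebraMap (c : K) : differential ε (algebraMap K R c) = 0 := by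
  simp [differential_eq_zero_iff]

theorem differential_image_sub_one (T : Set R) :
    differential ε '' ((fun t => t - 1) '' T) = differential ε '' T := by
  have hone : differential ε 1 = 0 := by rw [← map_one (algebraMap K R), differential_algebraMap]
  simp only [Set.image_image, map_sub, hone, sub_zero]

theorem differential_surjective : Function.Surjective (differential ε) := fun v => by
  obtain ⟨⟨x, hx⟩, rfl⟩ := (RingHom.ker ε).toCotangent_surjective v
  refine ⟨x, congrArg _ (Subtype.ext ?_)⟩
  change x - algebraMap K R (ε x) = x
  rw [RingHom.mem_ker.1 hx, map_zero, sub_zero]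

theorem differential_mul (a b : R) :
    differential ε (a * b) = ε a • differential ε b + ε b • differential ε a := by
  rw [← sub_eq_zero, ← map_smul, ← map_smul, ← map_add, ← map_sub, differential_eq_zero_iff]
  have hprod : a * b - (ε a • b + ε b • a) -
      algebraMap K R (ε (a * b - (ε a • b + ε b • a))) =
      (a - algebraMap K R (ε a)) * (b - algebraMap K R (ε b)) := by
    simp only [Algebra.smul_def, map_sub, map_add, map_mul, AlgHom.commutes,
      Algebra.algebraMap_self, RingHom.id_apply]
    ring
  rw [hprod, pow_two]
  exact Ideal.mul_mem_mul (by simp) (by simp)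

theorem span_differential_eq_top {T : Set R} (hT : Algebra.adjoin K T = ⊤) :
    Submodule.span K (differential ε '' T) = ⊤ := by
  refine eq_top_iff.2 fun v _ => ?_
  obtain ⟨x, rfl⟩ := differential_surjective ε v
  have hx : x ∈ Algebra.adjoin K T := hT ▸ Algebra.mem_top
  induction hx using Algebra.adjoin_induction with
  | mem x hx => exact Submodule.subset_span ⟨x, hx, rfl⟩
  | algebraMap c => simp [differential_algebraMap]
  | add a b _ _ ha hb => simpa using add_mem (ha trivial) (hb trivial)
  | mul a b _ _ ha hb =>
    rw [differential_mul]
    exact add_mem (Submodule.smul_mem _ _ (hb trivial)) (Submodule.smul_mem _ _ (ha trivial))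

theorem encard_le_of_linearIndepOn_differential {S T : Set R}
    (hS : LinearIndepOn K (differential ε) S) (hT : Algebra.adjoin K T = ⊤) :
    S.encard ≤ T.encard := by
  have hrank := rank_span_le (R := K) (differential ε '' T)
  rw [span_differential_eq_top ε hT, rank_top] at hrank
  calc S.encard ≤ Cardinal.toENat (Module.rank K (RingHom.ker ε).Cotangent) :=
        hS.encard_le_toENat_rank
    _ ≤ (differential ε '' T).encard := OrderHomClass.mono Cardinal.toENat hrank
    _ ≤ T.encard := Set.encard_image_le _ _

theorem linearIndepOn_of_ker_le {M V W : Type*} [AddCommGroup M] [Module K M] [AddCommGroup V]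
    [Module K V] [AddCommGroup W] [Module K W] {f : M →ₗ[K] V} {g : M →ₗ[K] W}
    (hgf : LinearMap.ker g ≤ LinearMap.ker f) {s : Set M} (hs : LinearIndepOn K f s) :
    LinearIndepOn K g s := by
  rw [linearIndepOn_iff'] at hs ⊢
  intro t c hts hc
  have hker : ∑ i ∈ t, c i • i ∈ LinearMap.ker g := by simpa using hc
  exact hs t c hts (by simpa using hgf hker)

variable {ε} {ε' : R' →ₐ[K] K} {f : R →ₐ[K] R'}

theorem differential_map_eq_zero {x : R} (hx : differential (ε'.comp f) x = 0) :
    differential ε' (f x) = 0 := by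
  have hker : (RingHom.ker (ε'.comp f)).map f ≤ RingHom.ker ε' :=
    Ideal.map_le_iff_le_comap.2 fun _ hy => hy
  have hsq := Ideal.mem_map_of_mem f ((differential_eq_zero_iff _).1 hx)
  rw [Ideal.map_pow, map_sub, AlgHom.commutes] at hsq
  exact (differential_eq_zero_iff ε').2 (Ideal.pow_right_mono hker 2 hsq)

theorem exists_mem_ker_sq_of_differential_map_eq_zero (hf : Function.Surjective f)
    (hε' : ε'.comp f = ε) {x : R} (hx : differential ε' (f x) = 0) :
    ∃ y ∈ RingHom.ker ε ^ 2, f y = f (x - algebraMap K R (ε x)) := by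
  have hmap : (RingHom.ker ε ^ 2).map f = RingHom.ker ε' ^ 2 := by
    rw [Ideal.map_pow, ← hε', ← Ideal.map_comap_of_surjective f hf (RingHom.ker ε')]
    rfl
  rw [differential_eq_zero_iff, ← hmap, Ideal.mem_map_iff_of_surjective f hf] at hx
  simpa [← hε'] using hx

theorem differential_mem_span_of_mem_ideal_span {T : Set R} (hT : ∀ t ∈ T, ε t = 0) {x : R}
    (hx : x ∈ Ideal.span T) : differential ε x ∈ Submodule.span K (differential ε '' T) := by
  induction hx using Submodule.span_induction with
  | mem x hx => exact Submodule.subset_span ⟨x, hx, rfl⟩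
  | zero => simp
  | add a b _ _ ha hb => simpa using add_mem ha hb
  | smul a x hx hdx =>
    have hεx : ε x = 0 := (Ideal.span_le.2 hT : Ideal.span T ≤ RingHom.ker ε) hx
    simpa [differential_mul, hεx] using Submodule.smul_mem _ (ε a) hdx

theorem linearIndepOn_differential_comp (hf : Function.Surjective f) (hε' : ε'.comp f = ε)
    {T : Set R} (hT : RingHom.ker f = Ideal.span T) {B : Set R}
    (hB : LinearIndepOn K
      ((Submodule.span K (differential ε '' T)).mkQ ∘ₗ differential ε) B) :
    LinearIndepOn K (differential ε' ∘ₗ f.toLinearMap) B := by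
  refine linearIndepOn_of_ker_le (fun x hx => ?_) hB
  obtain ⟨y, hy, hfy⟩ := exists_mem_ker_sq_of_differential_map_eq_zero hf hε' hx
  have hTε : ∀ t ∈ T, ε t = 0 := fun t ht => by
    have hft : f t = 0 := (hT ▸ Ideal.subset_span ht : t ∈ RingHom.ker f)
    rw [← hε', AlgHom.comp_apply, hft, map_zero]
  have hmem : x - algebraMap K R (ε x) - y ∈ Ideal.span T := by
    rw [← hT, RingHom.mem_ker, map_sub, hfy, sub_self]
  have hspan := differential_mem_span_of_mem_ideal_span hTε hmem
  rw [map_sub, map_sub, differential_algebraMap, differential_eq_zero_of_mem ε hy, sub_zero,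
    sub_zero] at hspan
  simpa using hspan

theorem linearIndepOn_differential_comp_of_union (hf : Function.Surjective f)
    (hε' : ε'.comp f = ε) {T B : Set R}
    (hT : RingHom.ker f = Ideal.span ((fun t => t - 1) '' T)) (hTB : Disjoint T B)
    (hLI : LinearIndepOn K (differential ε) (T ∪ B)) :
    LinearIndepOn K (differential ε' ∘ₗ f.toLinearMap) B := by
  refine linearIndepOn_differential_comp hf hε' hT ?_
  rw [differential_image_sub_one]
  exact ((linearIndepOn_union_iff_quotient hTB).1 hLI).2

end Differential

section MinimalGenerating

variable {R : Type*} [CommRing R] [Algebra ℂ R] {ε : R →ₐ[ℂ] ℂ} {S : Set R}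

theorem encard_eq_minNumGenerators (hS : LinearIndepOn ℂ (differential ε) S)
    (hgen : Algebra.adjoin ℂ S = ⊤) : S.encard = minNumGenerators R :=
  le_antisymm (le_iInf₂ fun _ hT => encard_le_of_linearIndepOn_differential ε hS hT)
    (iInf₂_le S hgen)

theorem isMinimalGenerating_of_linearIndepOn_differential
    (hS : LinearIndepOn ℂ (differential ε) S) (hgen : Algebra.adjoin ℂ S = ⊤) :
    IsMinimalGenerating S := by
  refine ⟨hgen, fun T hT hTS s hs => ?_⟩
  by_contra hsT
  have hTs : T ⊆ S \ {s} := Set.subset_sdiff_singleton hTS hsT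
  refine hS.notMem_span hs (Submodule.span_mono (Set.image_mono hTs) ?_)
  rw [span_differential_eq_top ε hT]
  trivial

end MinimalGenerating

section GradedProj

variable {K R : Type*} [CommSemiring K] [Semiring R] [Algebra K R]
  {𝒜 : ℕ → Submodule K R} [GradedAlgebra 𝒜]

theorem gradedProj_eq_self_of_mem {i : ℕ} {x : R} (hx : x ∈ 𝒜 i) : GradedAlgebra.proj 𝒜 i x = x :=
  DirectSum.decompose_of_mem_same 𝒜 hx

theorem gradedProj_eq_zero_of_mem {i j : ℕ} {x : R} (hx : x ∈ 𝒜 i) (hij : i ≠ j) :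
    GradedAlgebra.proj 𝒜 j x = 0 :=
  DirectSum.decompose_of_mem_ne 𝒜 hx hij

theorem gradedProj_mem (i : ℕ) (x : R) : GradedAlgebra.proj 𝒜 i x ∈ 𝒜 i :=
  SetLike.coe_mem _

theorem gradedProj_mul (n : ℕ) (a b : R) :
    GradedAlgebra.proj 𝒜 n (a * b) = ∑ ij ∈ Finset.HasAntidiagonal.antidiagonal n,
      GradedAlgebra.proj 𝒜 ij.1 a * GradedAlgebra.proj 𝒜 ij.2 b := by
  rw [GradedAlgebra.proj_apply, DirectSum.decompose_mul,
    DirectSum.coe_mul_apply_eq_sum_antidiagonal]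
  rfl

theorem exists_gradedProj_ne_zero {x : R} (hx : x ≠ 0) :
    ∃ m, GradedAlgebra.proj 𝒜 m x ≠ 0 ∧ ∀ j > m, GradedAlgebra.proj 𝒜 j x = 0 := by
  classical
  have hne : (DirectSum.decompose 𝒜 x).support.Nonempty := by
    rw [Finset.nonempty_iff_ne_empty, ne_eq, DFinsupp.support_eq_empty]
    exact fun h => hx ((DirectSum.decompose 𝒜).injective (by simpa using h))
  have hmem : ∀ j, j ∈ (DirectSum.decompose 𝒜 x).support ↔ GradedAlgebra.proj 𝒜 j x ≠ 0 := by
    intro j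
    rw [DFinsupp.mem_support_iff, ne_eq, ← ZeroMemClass.coe_eq_zero]
    rfl
  exact ⟨_, (hmem _).1 (Finset.max'_mem _ hne), fun j hj => by_contra fun h =>
    hj.not_ge (Finset.le_max' _ j ((hmem j).2 h))⟩

theorem gradedProj_mem_span {H : Set R} (hH : ∀ h ∈ H, SetLike.IsHomogeneousElem 𝒜 h) {x : R}
    (hx : x ∈ Submodule.span K H) (m : ℕ) :
    GradedAlgebra.proj 𝒜 m x ∈ Submodule.span K H := by
  induction hx using Submodule.span_induction with
  | mem h hhH =>
    obtain ⟨i, hi⟩ := hH h hhH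
    rcases eq_or_ne i m with rfl | him
    · rw [gradedProj_eq_self_of_mem hi]
      exact Submodule.subset_span hhH
    · rw [gradedProj_eq_zero_of_mem hi him]
      exact zero_mem _
  | zero => simp
  | add a b _ _ ha hb => simpa only [map_add] using add_mem ha hb
  | smul c a _ ha => simpa only [map_smul] using Submodule.smul_mem _ c ha

theorem gradedProj_map_eq_of_top {τ : R →ₐ[K] R}
    (hτ : ∀ m, ∀ x ∈ 𝒜 m, ∀ j ≥ m, GradedAlgebra.proj 𝒜 j (τ x) = GradedAlgebra.proj 𝒜 j x)
    {m : ℕ} {x : R} (hx : ∀ j > m, GradedAlgebra.proj 𝒜 j x = 0) :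
    GradedAlgebra.proj 𝒜 m (τ x) = GradedAlgebra.proj 𝒜 m x := by
  classical
  conv_lhs => rw [← DirectSum.sum_support_decompose 𝒜 x]
  conv_rhs => rw [← DirectSum.sum_support_decompose 𝒜 x]
  simp only [map_sum]
  refine Finset.sum_congr rfl fun j _ => ?_
  rcases le_or_gt j m with hjm | hjm
  · exact hτ j _ (SetLike.coe_mem _) m hjm
  · have hj0 : ((DirectSum.decompose 𝒜 x j : 𝒜 j) : R) = 0 := hx j hjm
    rw [hj0, map_zero]

end GradedProj

section ConnectedGraded

variable {K R : Type*} [Field K] [CommRing R] [Algebra K R] {ε : R →ₐ[K] K}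
  {𝒜 : ℕ → Submodule K R} [GradedAlgebra 𝒜]

/-- `ε` is the augmentation of the connected graded algebra `R`: the component of degree zero of
every element is the scalar that `ε` assigns to it. -/
def IsAugmentation (𝒜 : ℕ → Submodule K R) [GradedAlgebra 𝒜] (ε : R →ₐ[K] K) : Prop :=
  ∀ x, GradedAlgebra.proj 𝒜 0 x = algebraMap K R (ε x)

section Augmentation

variable (hε : IsAugmentation 𝒜 ε)
include hε

theorem augmentation_eq_zero_of_mem {i : ℕ} (hi : i ≠ 0) {x : R} (hx : x ∈ 𝒜 i) : ε x = 0 := by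
  have hproj := hε x
  rw [gradedProj_eq_zero_of_mem hx hi] at hproj
  simpa using congrArg ε hproj.symm

theorem gradedProj_zero_eq_zero {x : R} (hx : x ∈ RingHom.ker ε) :
    GradedAlgebra.proj 𝒜 0 x = 0 := by
  rw [hε, RingHom.mem_ker.1 hx, map_zero]

theorem isHomogeneous_ker_augmentation : (RingHom.ker ε).IsHomogeneous 𝒜 := by
  intro i x hx
  change GradedAlgebra.proj 𝒜 i x ∈ _
  rcases eq_or_ne i 0 with rfl | hi
  · rw [gradedProj_zero_eq_zero hε hx]
    exact zero_mem _
  · exact augmentation_eq_zero_of_mem hε hi (gradedProj_mem i x)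

theorem differential_gradedProj_eq_zero {x : R} (hx : differential ε x = 0) (m : ℕ) :
    differential ε (GradedAlgebra.proj 𝒜 m x) = 0 := by
  rcases eq_or_ne m 0 with rfl | hm
  · rw [hε, differential_algebraMap]
  · have hsq : (RingHom.ker ε ^ 2).IsHomogeneous 𝒜 := by
      rw [pow_two]
      exact (isHomogeneous_ker_augmentation hε).mul (isHomogeneous_ker_augmentation hε)
    have hmem : GradedAlgebra.proj 𝒜 m (x - algebraMap K R (ε x)) ∈ RingHom.ker ε ^ 2 :=
      hsq m ((differential_eq_zero_iff ε).1 hx)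
    rw [map_sub, ← hε x, gradedProj_eq_zero_of_mem (gradedProj_mem 0 x) hm.symm, sub_zero] at hmem
    exact differential_eq_zero_of_mem ε hmem

theorem gradedProj_mul_mem_adjoin {H : Set R} {m : ℕ}
    (hH : ∀ i < m, (𝒜 i : Set R) ⊆ Algebra.adjoin K H) {a b : R}
    (ha : a ∈ RingHom.ker ε) (hb : b ∈ RingHom.ker ε) :
    GradedAlgebra.proj 𝒜 m (a * b) ∈ Algebra.adjoin K H := by
  rw [gradedProj_mul]
  refine sum_mem fun ij hij => ?_
  have hsum := Finset.HasAntidiagonal.mem_antidiagonal.1 hij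
  rcases Nat.eq_zero_or_pos ij.1 with h1 | h1
  · rw [h1, gradedProj_zero_eq_zero hε ha, zero_mul]
    exact zero_mem _
  rcases Nat.eq_zero_or_pos ij.2 with h2 | h2
  · rw [h2, gradedProj_zero_eq_zero hε hb, mul_zero]
    exact zero_mem _
  exact mul_mem (hH _ (by omega) (gradedProj_mem _ a)) (hH _ (by omega) (gradedProj_mem _ b))

theorem gradedProj_mem_adjoin_of_mem_ker_sq {H : Set R} {m : ℕ}
    (hH : ∀ i < m, (𝒜 i : Set R) ⊆ Algebra.adjoin K H) {x : R} (hx : x ∈ RingHom.ker ε ^ 2) :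
    GradedAlgebra.proj 𝒜 m x ∈ Algebra.adjoin K H := by
  rw [pow_two] at hx
  induction hx using Submodule.mul_induction_on' with
  | mem_mul_mem a ha b hb => exact gradedProj_mul_mem_adjoin hε hH ha hb
  | add a _ b _ ha hb => simpa only [map_add] using add_mem ha hb

/-- Nakayama's lemma for connected graded algebras. -/
theorem adjoin_eq_top_of_span_differential_eq_top {H : Set R}
    (hH : ∀ h ∈ H, SetLike.IsHomogeneousElem 𝒜 h)
    (hspan : Submodule.span K (differential ε '' H) = ⊤) : Algebra.adjoin K H = ⊤ := by
  have hcomp (m : ℕ) : (𝒜 m : Set R) ⊆ Algebra.adjoin K H := by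
    induction m using Nat.strong_induction_on with
    | _ m ih =>
      intro x hx
      rcases eq_or_ne m 0 with rfl | hm
      · rw [← gradedProj_eq_self_of_mem hx, hε]
        exact (Algebra.adjoin K H).algebraMap_mem _
      obtain ⟨y, hy, hyx⟩ : differential ε x ∈ (Submodule.span K H).map (differential ε) := by
        rw [Submodule.map_span, hspan]
        trivial
      have hxy : differential ε (x - y) = 0 := by rw [map_sub, hyx, sub_self]
      have hdiff := gradedProj_mem_adjoin_of_mem_ker_sq hε ih ((differential_eq_zero_iff ε).1 hxy)
      rw [← hε (x - y), map_sub, gradedProj_eq_zero_of_mem (gradedProj_mem 0 _) hm.symm, sub_zero,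
        map_sub, gradedProj_eq_self_of_mem hx] at hdiff
      have hy' := Algebra.span_le_adjoin K H (gradedProj_mem_span hH hy m)
      simpa only [sub_add_cancel, SetLike.mem_coe] using add_mem hdiff hy'
  refine eq_top_iff.2 fun x _ => ?_
  induction x using DirectSum.Decomposition.inductionOn 𝒜 with
  | zero => exact zero_mem _
  | homogeneous x => exact hcomp _ x.2
  | add a b ha hb => exact add_mem (ha trivial) (hb trivial)

theorem linearIndepOn_differential_of_minimal {H : Set R}
    (hH : ∀ h ∈ H, SetLike.IsHomogeneousElem 𝒜 h)
    (hmin : Minimal (fun T : Set R => Algebra.adjoin K T = ⊤) H) :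
    LinearIndepOn K (differential ε) H := by
  have hempty : LinearIndepOn K (differential ε) (∅ : Set R) := linearIndepOn_empty K _
  have hsub := hempty.extend_subset (Set.empty_subset H)
  have hgen : Algebra.adjoin K (hempty.extend (Set.empty_subset H)) = ⊤ := by
    refine adjoin_eq_top_of_span_differential_eq_top hε (fun h hh => hH h (hsub hh)) ?_
    rw [hempty.span_image_extend_eq_span_image, span_differential_eq_top ε hmin.prop]
  rw [← hmin.eq_of_subset hgen hsub]
  exact hempty.linearIndepOn_extend _

theorem comp_gradedProj_mul_eq_zero {n : ℕ} {ψ : R →ₐ[K] K}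
    (hψ : ∀ i, i ≠ 0 → i < n → ∀ x ∈ 𝒜 i, ψ x = 0) {a b : R}
    (ha : a ∈ RingHom.ker ε) (hb : b ∈ RingHom.ker ε) :
    ψ (GradedAlgebra.proj 𝒜 n (a * b)) = 0 := by
  rw [gradedProj_mul, map_sum]
  refine Finset.sum_eq_zero fun ij hij => ?_
  have hsum := Finset.HasAntidiagonal.mem_antidiagonal.1 hij
  rw [map_mul]
  rcases Nat.eq_zero_or_pos ij.1 with h1 | h1
  · rw [h1, gradedProj_zero_eq_zero hε ha, map_zero, zero_mul]
  rcases Nat.eq_zero_or_pos ij.2 with h2 | h2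
  · rw [h2, gradedProj_zero_eq_zero hε hb, map_zero, mul_zero]
  rw [hψ ij.1 h1.ne' (by omega) _ (gradedProj_mem _ a), zero_mul]

theorem exists_dual_comp_differential {n : ℕ} (hn : n ≠ 0) {ψ : R →ₐ[K] K}
    (hψ : ∀ i, i ≠ 0 → i < n → ∀ x ∈ 𝒜 i, ψ x = 0) :
    ∃ φ : Module.Dual K (RingHom.ker ε).Cotangent,
      ∀ x, φ (differential ε x) = ψ (GradedAlgebra.proj 𝒜 n x) := by
  let χ : Module.Dual K R := ψ.toLinearMap ∘ₗ GradedAlgebra.proj 𝒜 n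
  suffices hχ : χ ∈ (LinearMap.ker (differential ε)).dualAnnihilator by
    rw [← LinearMap.range_dualMap_eq_dualAnnihilator_ker] at hχ
    obtain ⟨φ, hφ⟩ := hχ
    exact ⟨φ, LinearMap.congr_fun hφ⟩
  have hsq : ∀ y ∈ RingHom.ker ε ^ 2, χ y = 0 := by
    intro y hy
    rw [pow_two] at hy
    induction hy using Submodule.mul_induction_on' with
    | mem_mul_mem a ha b hb => exact comp_gradedProj_mul_eq_zero hε hψ ha hb
    | add a _ b _ ha hb => rw [map_add, ha, hb, add_zero]
  rw [Submodule.mem_dualAnnihilator]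
  intro x hx
  have hx' := hsq _ ((differential_eq_zero_iff ε).1 hx)
  rw [map_sub, ← hε x, LinearMap.comp_apply,
    LinearMap.comp_apply, gradedProj_eq_zero_of_mem (gradedProj_mem 0 x) hn.symm, map_zero,
    sub_zero] at hx'
  exact hx'

/-- The top component of a relation among the differentials at `ε ∘ τ` is a relation among the
differentials at `ε`. -/
theorem linearIndepOn_differential_comp_of_gradedProj {τ : R →ₐ[K] R}
    (hτ : ∀ m, ∀ x ∈ 𝒜 m, ∀ j ≥ m, GradedAlgebra.proj 𝒜 j (τ x) = GradedAlgebra.proj 𝒜 j x)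
    {H : Set R} (hH : ∀ h ∈ H, SetLike.IsHomogeneousElem 𝒜 h)
    (hLI : LinearIndepOn K (differential ε) H) :
    LinearIndepOn K (differential (ε.comp τ)) H := by
  have hspan : Set.range ((↑) : H → R) = H := Subtype.range_coe
  have hdisj := Submodule.range_ker_disjoint hLI
  refine (LinearMap.linearIndependent_iff_of_disjoint (v := ((↑) : H → R)) _ ?_).2
    (LinearIndependent.of_comp _ hLI)
  rw [hspan, Submodule.disjoint_def] at hdisj ⊢
  intro f hf hdf
  have hdτf : differential ε (τ f) = 0 := differential_map_eq_zero hdf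
  by_contra hf0
  obtain ⟨m, hm, htop⟩ := exists_gradedProj_ne_zero (𝒜 := 𝒜) hf0
  refine hm (hdisj _ (gradedProj_mem_span hH hf m) ?_)
  rw [LinearMap.mem_ker, ← gradedProj_map_eq_of_top hτ htop]
  exact differential_gradedProj_eq_zero hε hdτf m

end Augmentation

end ConnectedGraded

section LinearAlgebra

variable {K V κ : Type*} [Field K] [AddCommGroup V] [Module K V] {v : κ → V}

theorem linearIndependent_mkQ_of_dual {W : Submodule K V} {φ : κ → Module.Dual K V}
    (hW : ∀ k, ∀ w ∈ W, φ k w = 0) (hne : ∀ k, φ k (v k) ≠ 0)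
    (hdual : ∀ j k, j ≠ k → φ k (v j) = 0) : LinearIndependent K (W.mkQ ∘ v) := by
  classical
  rw [linearIndependent_iff']
  intro s c hc k hk
  have hmem : ∑ j ∈ s, c j • v j ∈ W := by
    rw [← W.ker_mkQ, LinearMap.mem_ker, map_sum]
    simpa only [Function.comp_apply, map_smul] using hc
  have hφ := hW k _ hmem
  rw [map_sum, Finset.sum_eq_single_of_mem k hk fun j _ hj => by
    rw [map_smul, hdual j k hj, smul_zero], map_smul, smul_eq_mul] at hφ
  exact (mul_eq_zero.1 hφ).resolve_right (hne k)

theorem span_union_range_eq_top [Fintype κ] {S T : Set V}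
    (hST : Submodule.span K (S ∪ T) = ⊤) (hT : T.encard ≤ Fintype.card κ)
    (hv : LinearIndependent K ((Submodule.span K S).mkQ ∘ v)) :
    Submodule.span K (S ∪ Set.range v) = ⊤ := by
  have hTfin : T.Finite := Set.finite_of_encard_le_coe hT
  have hTQ : Submodule.span K ((Submodule.span K S).mkQ '' T) = ⊤ := by
    rw [← Submodule.map_span, Submodule.map_mkQ_eq_top, ← Submodule.span_union, hST]
  have : Module.Finite K (V ⧸ Submodule.span K S) :=
    ⟨Submodule.fg_def.2 ⟨_, hTfin.image _, hTQ⟩⟩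
  have hfinrank : Module.finrank K (V ⧸ Submodule.span K S) ≤ Fintype.card κ := by
    have : Fintype ((Submodule.span K S).mkQ '' T) := (hTfin.image _).fintype
    have hncard : T.ncard ≤ Fintype.card κ := by
      rwa [← Nat.cast_le (α := ℕ∞), hTfin.cast_ncard_eq]
    calc Module.finrank K (V ⧸ Submodule.span K S)
        = Module.finrank K (Submodule.span K ((Submodule.span K S).mkQ '' T)) := by
          rw [hTQ, finrank_top]
      _ ≤ ((Submodule.span K S).mkQ '' T).toFinset.card := finrank_span_le_card _
      _ = ((Submodule.span K S).mkQ '' T).ncard := (Set.ncard_eq_toFinset_card' _).symm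
      _ ≤ Fintype.card κ := (Set.ncard_image_le hTfin).trans hncard
  have hspan := hv.span_eq_top_of_card_eq_finrank' (hv.fintype_card_le_finrank.antisymm hfinrank)
  rwa [Set.range_comp, ← Submodule.map_span, Submodule.map_mkQ_eq_top, ← Submodule.span_union]
    at hspan

end LinearAlgebra

section InducedGrading

variable {K A : Type*} [CommRing K] [CommRing A] [Algebra K A]
  (𝒜 : ℕ → Submodule K A) [GradedAlgebra 𝒜] (S : Subalgebra K A)

/-- The grading that a graded algebra induces on a subalgebra containing the components of its
elements. -/
def inducedGrading (i : ℕ) : Submodule K S :=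
  (𝒜 i).comap S.val.toLinearMap

variable {S}

theorem gradedProj_coe_coeAddMonoidHom (d : DirectSum ℕ fun i => inducedGrading 𝒜 S i) (i : ℕ) :
    GradedAlgebra.proj 𝒜 i (DirectSum.coeAddMonoidHom (inducedGrading 𝒜 S) d : S) = (d i : S) := by
  induction d using DirectSum.induction_on with
  | zero => simp
  | of j x =>
    rw [DirectSum.coeAddMonoidHom_of]
    rcases eq_or_ne j i with rfl | hji
    · rw [DirectSum.of_eq_same]
      exact gradedProj_eq_self_of_mem (𝒜 := 𝒜) x.2
    · rw [DirectSum.of_eq_of_ne _ _ _ hji.symm]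
      exact gradedProj_eq_zero_of_mem (𝒜 := 𝒜) x.2 hji
  | add d e hd he => simp only [map_add, DirectSum.add_apply, Submodule.coe_add,
      Subalgebra.coe_add, hd, he]

theorem isInternal_inducedGrading (hS : ∀ x ∈ S, ∀ i, GradedAlgebra.proj 𝒜 i x ∈ S) :
    DirectSum.IsInternal (inducedGrading 𝒜 S) := by
  classical
  refine ⟨(injective_iff_map_eq_zero _).2 fun d hd => ?_, fun x => ?_⟩
  · ext i
    rw [← gradedProj_coe_coeAddMonoidHom, hd]
    simp
  · let component (i : ℕ) : inducedGrading 𝒜 S i :=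
      ⟨⟨GradedAlgebra.proj 𝒜 i x, hS x x.2 i⟩, gradedProj_mem (𝒜 := 𝒜) i (x : A)⟩
    refine ⟨∑ i ∈ (DirectSum.decompose 𝒜 (x : A)).support, DirectSum.of _ i (component i), ?_⟩
    simp only [map_sum, DirectSum.coeAddMonoidHom_of]
    refine Subtype.ext ((AddSubmonoidClass.coe_finsetSum _ _).trans ?_)
    exact DirectSum.sum_support_decompose 𝒜 (x : A)

/-- A subalgebra containing the components of its elements is a graded algebra. -/
noncomputable abbrev inducedGradedAlgebra (hS : ∀ x ∈ S, ∀ i, GradedAlgebra.proj 𝒜 i x ∈ S) :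
    GradedAlgebra (inducedGrading 𝒜 S) where
  one_mem := SetLike.GradedOne.one_mem (A := 𝒜)
  mul_mem := fun _ _ _ _ hx hy => SetLike.GradedMul.mul_mem (A := 𝒜) hx hy
  __ := (isInternal_inducedGrading 𝒜 hS).chooseDecomposition

theorem coe_gradedProj_inducedGrading [GradedAlgebra (inducedGrading 𝒜 S)] (i : ℕ) (x : S) :
    (GradedAlgebra.proj (inducedGrading 𝒜 S) i x : A) = GradedAlgebra.proj 𝒜 i x := by
  conv_rhs => rw [← DirectSum.Decomposition.left_inv (ℳ := inducedGrading 𝒜 S) x]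
  rw [gradedProj_coe_coeAddMonoidHom]
  rfl

end InducedGrading

open MvPolynomial

section Polynomials

variable {σ τ M R : Type*} [AddCommMonoid M] [CommSemiring R]

theorem isWeightedHomogeneous_aeval {w : σ → M} {w' : τ → M} {f : σ → MvPolynomial τ R}
    (hf : ∀ i, IsWeightedHomogeneous w' (f i) (w i)) {p : MvPolynomial σ R} {m : M}
    (hp : IsWeightedHomogeneous w p m) : IsWeightedHomogeneous w' (aeval f p) m := by
  rw [aeval_def, eval₂_eq]
  refine IsWeightedHomogeneous.sum _ _ _ fun s hs => IsWeightedHomogeneous.C_mul ?_ _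
  rw [← hp (mem_support_iff.1 hs), Finsupp.weight_apply]
  exact IsWeightedHomogeneous.prod _ _ _ fun i _ => (hf i).pow _

theorem aeval_weightedHomogeneousComponent {w : σ → M} {w' : τ → M} {f : σ → MvPolynomial τ R}
    (hf : ∀ i, IsWeightedHomogeneous w' (f i) (w i)) (p : MvPolynomial σ R) (m : M) :
    aeval f (weightedHomogeneousComponent w m p) =
      weightedHomogeneousComponent w' m (aeval f p) := by
  classical
  induction p using MvPolynomial.induction_on' with
  | monomial s c =>
    have hs := isWeightedHomogeneous_monomial w s c rfl
    have hfs := isWeightedHomogeneous_aeval hf hs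
    rcases eq_or_ne m (Finsupp.weight w s) with rfl | hm
    · rw [hs.weightedHomogeneousComponent_same, hfs.weightedHomogeneousComponent_same]
    · rw [hs.weightedHomogeneousComponent_ne m hm, hfs.weightedHomogeneousComponent_ne m hm,
        map_zero]
  | add p q hp hq => simp only [map_add, hp, hq]

theorem eval_mul_of_isWeightedHomogeneous {R : Type*} [CommRing R] {w : σ → M}
    (χ : Multiplicative M →* R) {p : MvPolynomial σ R} {m : M} (hp : IsWeightedHomogeneous w p m)
    (x : σ → R) :
    eval (fun i => χ (Multiplicative.ofAdd (w i)) * x i) p =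
      χ (Multiplicative.ofAdd m) * eval x p := by
  rw [eval_eq, eval_eq, Finset.mul_sum]
  refine Finset.sum_congr rfl fun d hd => ?_
  rw [← hp (mem_support_iff.1 hd), Finsupp.weight_apply, Finsupp.sum, ofAdd_sum, map_prod]
  simp only [mul_pow, Finset.prod_mul_distrib, ofAdd_nsmul, map_pow]
  ring

attribute [local instance] MvPolynomial.gradedAlgebra

theorem gradedProj_homogeneousSubmodule (m : ℕ) (p : MvPolynomial σ R) :
    GradedAlgebra.proj (homogeneousSubmodule σ R) m p = homogeneousComponent m p :=
  decomposition.decompose'_apply p m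

theorem homogeneousComponent_add_mul_of_isHomogeneous {l : MvPolynomial σ R} {i : ℕ}
    (hl : l.IsHomogeneous i) (m : ℕ) (p : MvPolynomial σ R) :
    homogeneousComponent (i + m) (l * p) = l * homogeneousComponent m p := by
  rw [← gradedProj_homogeneousSubmodule, ← gradedProj_homogeneousSubmodule,
    GradedAlgebra.proj_apply]
  exact DirectSum.coe_decompose_mul_add_of_left_mem (homogeneousSubmodule σ R) hl

theorem aeval_X_add_C_of_isHomogeneous_one (c : σ → R) {l : MvPolynomial σ R}
    (hl : l.IsHomogeneous 1) : aeval (fun i => X i + C (c i)) l = l + C (eval c l) := by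
  have hl' : l ∈ homogeneousSubmodule σ R 1 := hl
  rw [homogeneousSubmodule_one_eq_span_X] at hl'
  clear hl
  induction hl' using Submodule.span_induction with
  | mem x hx =>
    obtain ⟨i, rfl⟩ := hx
    simp
  | zero => simp
  | add x y _ _ hx hy =>
    rw [map_add, map_add, map_add, hx, hy, add_add_add_comm]
  | smul a x _ hx => rw [map_smul, hx, smul_add, smul_eval, smul_eq_C_mul (C _), ← C_mul]

theorem homogeneousComponent_aeval_X_add_C (c : σ → R) {p : MvPolynomial σ R} {m : ℕ}
    (hp : p.IsHomogeneous m) {j : ℕ} (hj : m ≤ j) :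
    homogeneousComponent j (aeval (fun i => X i + C (c i)) p) = homogeneousComponent j p := by
  have hmem : p ∈ homogeneousSubmodule σ R 1 ^ m := by rwa [homogeneousSubmodule_one_pow]
  induction hmem using Submodule.pow_induction_on_left' generalizing j with
  | algebraMap a => rw [AlgHom.commutes]
  | add x y i hx hy hcx hcy =>
    rw [homogeneousSubmodule_one_pow] at hx hy
    simp only [map_add, hcx hx hj, hcy hy hj]
  | mem_mul l hl i q hq hcq =>
    rw [homogeneousSubmodule_one_pow] at hq
    obtain ⟨j, rfl⟩ : ∃ k, j = 1 + k := ⟨j - 1, by omega⟩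
    have hqj : homogeneousComponent (1 + j) q = 0 := by
      rw [homogeneousComponent_of_mem hq, if_neg (by omega)]
    rw [map_mul, aeval_X_add_C_of_isHomogeneous_one c hl, add_mul, map_add,
      homogeneousComponent_C_mul, homogeneousComponent_add_mul_of_isHomogeneous hl,
      homogeneousComponent_add_mul_of_isHomogeneous hl, hcq hq (by omega), hcq hq (by omega), hqj,
      mul_zero, add_zero]

end Polynomials

variable {n r : ℕ}

theorem evalAt_eq_eval (A : Fin r → Matrix (Fin n) (Fin n) ℂ) (p : PolyRing n r) :
    evalAt A p = eval (fun x => A x.1 x.2.1 x.2.2) p :=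
  rfl

theorem ext_evalAt {p q : PolyRing n r} (h : ∀ A, evalAt A p = evalAt A q) : p = q :=
  MvPolynomial.funext fun x => by
    simpa only [evalAt_eq_eval, Matrix.of_apply] using h fun k => .of fun i j => x (k, i, j)

theorem evalAt_zero (p : PolyRing n r) : evalAt 0 p = coeff 0 p :=
  aeval_zero' p

theorem mapMatrix_genericMatrix (A : Fin r → Matrix (Fin n) (Fin n) ℂ) (k : Fin r) :
    (evalAt A).mapMatrix (genericMatrix n r k) = A k := by
  ext i j
  simp [genericMatrix, evalAt]

/-- The substitution of an `r`-tuple of matrices of polynomials for the generic matrices. -/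
noncomputable def substMatrices (M : Fin r → Matrix (Fin n) (Fin n) (PolyRing n r)) :
    PolyRing n r →ₐ[ℂ] PolyRing n r :=
  aeval fun x => M x.1 x.2.1 x.2.2

theorem evalAt_substMatrices (M : Fin r → Matrix (Fin n) (Fin n) (PolyRing n r))
    (A : Fin r → Matrix (Fin n) (Fin n) ℂ) (p : PolyRing n r) :
    evalAt A (substMatrices M p) = evalAt (fun k => (evalAt A).mapMatrix (M k)) p := by
  rw [substMatrices, ← AlgHom.comp_apply, comp_aeval]
  rfl

/-- The action of `GL(n, ℂ)` on polynomials by simultaneous conjugation of the generic matrices. -/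
noncomputable def conjHom (g : GL (Fin n) ℂ) : PolyRing n r →ₐ[ℂ] PolyRing n r :=
  substMatrices fun k => (g : Matrix (Fin n) (Fin n) ℂ).map C * genericMatrix n r k *
    ((g⁻¹ : GL (Fin n) ℂ) : Matrix (Fin n) (Fin n) ℂ).map C

theorem evalAt_conjHom (g : GL (Fin n) ℂ) (A : Fin r → Matrix (Fin n) (Fin n) ℂ)
    (p : PolyRing n r) : evalAt A (conjHom g p) =
      evalAt (fun k => (g : Matrix (Fin n) (Fin n) ℂ) * A k *
        ((g⁻¹ : GL (Fin n) ℂ) : Matrix (Fin n) (Fin n) ℂ)) p := by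
  have hC (B : Matrix (Fin n) (Fin n) ℂ) : (evalAt A).mapMatrix (B.map C) = B := by
    ext i j
    simp [evalAt]
  simp only [conjHom, evalAt_substMatrices, map_mul, hC, mapMatrix_genericMatrix]

theorem mem_invGL_iff {p : PolyRing n r} : p ∈ invGL n r ↔ ∀ g, conjHom g p = p :=
  ⟨fun hp g => ext_evalAt fun A => (evalAt_conjHom g A p).trans (hp g A),
    fun hp g A => by rw [← evalAt_conjHom, hp]⟩

section Weights

variable {M : Type*} [AddCommMonoid M] (ω : Fin r → M)

theorem conjHom_weightedHomogeneousComponent (g : GL (Fin n) ℂ) (m : M) (p : PolyRing n r) :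
    conjHom g (weightedHomogeneousComponent (fun x => ω x.1) m p) =
      weightedHomogeneousComponent (fun x => ω x.1) m (conjHom g p) := by
  refine aeval_weightedHomogeneousComponent (fun x => ?_) p m
  simp only [Matrix.mul_apply, Matrix.map_apply, Finset.sum_mul]
  refine IsWeightedHomogeneous.sum _ _ _ fun j _ => IsWeightedHomogeneous.sum _ _ _ fun i _ => ?_
  rw [mul_comm]
  exact ((isWeightedHomogeneous_X ℂ (fun x : Fin r × Fin n × Fin n => ω x.1) _).C_mul _).C_mul _

theorem weightedHomogeneousComponent_mem_invGL {p : PolyRing n r} (hp : p ∈ invGL n r) (m : M) :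
    weightedHomogeneousComponent (fun x => ω x.1) m p ∈ invGL n r :=
  mem_invGL_iff.2 fun g => by
    rw [conjHom_weightedHomogeneousComponent, mem_invGL_iff.1 hp]

end Weights

section Grading

attribute [local instance] MvPolynomial.gradedAlgebra

/-- The grading of the algebra of invariants by degree. -/
noncomputable def invGrading (n r : ℕ) : ℕ → Submodule ℂ (invGL n r) :=
  inducedGrading (homogeneousSubmodule (Fin r × Fin n × Fin n) ℂ) (invGL n r)

theorem mem_invGrading {m : ℕ} {p : invGL n r} :
    p ∈ invGrading n r m ↔ (p : PolyRing n r).IsHomogeneous m :=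
  Iff.rfl

noncomputable instance : GradedAlgebra (invGrading n r) :=
  inducedGradedAlgebra _ fun p hp m => by
    rw [gradedProj_homogeneousSubmodule]
    exact weightedHomogeneousComponent_mem_invGL (fun _ => 1) hp m

theorem coe_gradedProj_invGrading (m : ℕ) (p : invGL n r) :
    (GradedAlgebra.proj (invGrading n r) m p : PolyRing n r) =
      homogeneousComponent m (p : PolyRing n r) :=
  letI : GradedAlgebra (inducedGrading (homogeneousSubmodule (Fin r × Fin n × Fin n) ℂ)
    (invGL n r)) := inferInstanceAs (GradedAlgebra (invGrading n r))
  (coe_gradedProj_inducedGrading _ m p).trans (gradedProj_homogeneousSubmodule m _)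

/-- Evaluation of an invariant at an `r`-tuple of matrices. -/
noncomputable def invEval (A : Fin r → Matrix (Fin n) (Fin n) ℂ) : invGL n r →ₐ[ℂ] ℂ :=
  (evalAt A).comp (invGL n r).val

theorem invEval_apply (A : Fin r → Matrix (Fin n) (Fin n) ℂ) (p : invGL n r) :
    invEval A p = evalAt A (p : PolyRing n r) :=
  rfl

/-- Evaluation of an invariant at the origin. -/
noncomputable def invAugmentation (n r : ℕ) : invGL n r →ₐ[ℂ] ℂ :=
  invEval 0

theorem isAugmentation_invAugmentation :
    IsAugmentation (invGrading n r) (invAugmentation n r) := fun p =>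
  Subtype.ext ((coe_gradedProj_invGrading 0 p).trans (by
    rw [homogeneousComponent_zero, ← evalAt_zero]
    rfl))

/-- The substitution `X_k ↦ X_k + 1` on invariants; it moves the origin to the point with all
entries equal to the identity matrix. -/
noncomputable def translateInv (n r : ℕ) : invGL n r →ₐ[ℂ] invGL n r :=
  ((substMatrices fun k => genericMatrix n r k + 1).comp (invGL n r).val).codRestrict (invGL n r)
    fun p g A => by
      have hconj (k : Fin r) : (g : Matrix (Fin n) (Fin n) ℂ) * A k *
          ((g⁻¹ : GL (Fin n) ℂ) : Matrix (Fin n) (Fin n) ℂ) + 1 =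
            g * (A k + 1) * ((g⁻¹ : GL (Fin n) ℂ) : Matrix (Fin n) (Fin n) ℂ) := by
        rw [mul_add, add_mul, mul_one, Units.mul_inv]
      simp only [AlgHom.comp_apply, evalAt_substMatrices, map_add, map_one,
        mapMatrix_genericMatrix, hconj]
      exact p.2 g _

theorem coe_translateInv (p : invGL n r) : (translateInv n r p : PolyRing n r) =
    substMatrices (fun k => genericMatrix n r k + 1) (p : PolyRing n r) :=
  rfl

theorem invAugmentation_comp_translateInv :
    (invAugmentation n r).comp (translateInv n r) = invEval 1 := by
  ext p
  rw [AlgHom.comp_apply, invAugmentation, invEval_apply, coe_translateInv, evalAt_substMatrices,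
    invEval_apply]
  simp only [map_add, map_one, mapMatrix_genericMatrix, Pi.zero_apply, zero_add]
  rfl

theorem gradedProj_translateInv {m : ℕ} {p : invGL n r} (hp : p ∈ invGrading n r m) {j : ℕ}
    (hj : m ≤ j) : GradedAlgebra.proj (invGrading n r) j (translateInv n r p) =
      GradedAlgebra.proj (invGrading n r) j p := by
  apply Subtype.ext
  rw [coe_gradedProj_invGrading, coe_gradedProj_invGrading]
  have htranslate : (translateInv n r p : PolyRing n r) =
      aeval (fun x => X x + C ((1 : Matrix (Fin n) (Fin n) ℂ) x.2.1 x.2.2)) (p : PolyRing n r) := by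
    refine congrArg (fun f => aeval f (p : PolyRing n r)) (funext fun x => ?_)
    simp only [genericMatrix, Matrix.add_apply, Matrix.of_apply, Matrix.one_apply]
    split_ifs <;> simp
  rw [htranslate]
  exact homogeneousComponent_aeval_X_add_C _ (mem_invGrading.1 hp) hj

end Grading

section Determinants

theorem evalAt_det (A : Fin r → Matrix (Fin n) (Fin n) ℂ) (k : Fin r) :
    evalAt A (genericMatrix n r k).det = (A k).det := by
  rw [AlgHom.map_det, mapMatrix_genericMatrix]

/-- The determinant of a generic matrix, as an invariant. -/
noncomputable def detInv (n : ℕ) {r : ℕ} (k : Fin r) : invGL n r :=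
  ⟨(genericMatrix n r k).det, fun g A => by
    rw [evalAt_det, evalAt_det, Matrix.det_units_conj]⟩

theorem invEval_detInv (A : Fin r → Matrix (Fin n) (Fin n) ℂ) (k : Fin r) :
    invEval A (detInv n k) = (A k).det :=
  evalAt_det A k

theorem invEval_traceInv (A : Fin r → Matrix (Fin n) (Fin n) ℂ) (w : List (Fin r)) :
    invEval A (traceInv n w) = (w.map A).prod.trace :=
  evalAt_traceWord A w

theorem isWeightedHomogeneous_detInv {M : Type*} [AddCommMonoid M] (ω : Fin r → M) (k : Fin r) :
    IsWeightedHomogeneous (fun x => ω x.1) (detInv n k : PolyRing n r) (n • ω k) := by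
  change IsWeightedHomogeneous _ (genericMatrix n r k).det _
  rw [Matrix.det_apply']
  refine IsWeightedHomogeneous.sum _ _ _ fun σ _ => ?_
  rw [← map_intCast (C : ℂ →+* PolyRing n r)]
  refine IsWeightedHomogeneous.C_mul ?_ _
  simpa using IsWeightedHomogeneous.prod Finset.univ (fun i => genericMatrix n r k (σ i) i)
    (fun _ => ω k) fun i _ => isWeightedHomogeneous_X ℂ (fun x => ω x.1) (k, σ i, i)

theorem detInv_mem_invGrading (k : Fin r) : detInv n k ∈ invGrading n r n := by
  have h := isWeightedHomogeneous_detInv (n := n) (fun _ : Fin r => 1) k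
  rwa [smul_eq_mul, mul_one] at h

theorem traceInv_mem_invGrading (w : List (Fin r)) :
    traceInv n w ∈ invGrading n r w.length := by
  have hentry : ∀ i j, ((w.map (genericMatrix n r)).prod i j).IsHomogeneous w.length := by
    induction w with
    | nil =>
      intro i j
      rw [List.map_nil, List.prod_nil, Matrix.one_apply]
      split_ifs
      · exact isHomogeneous_one _ _
      · exact isHomogeneous_zero _ _ _
    | cons k w ih =>
      intro i j
      rw [List.map_cons, List.prod_cons, Matrix.mul_apply, List.length_cons, add_comm]
      exact IsHomogeneous.sum _ _ _ fun l _ => (isHomogeneous_X ℂ (k, i, l)).mul (ih l j)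
  exact IsHomogeneous.sum _ _ _ fun i _ => hentry i i

end Determinants

section DualFunctionals

theorem evalAt_smul_of_isHomogeneous (c : ℂ) {p : PolyRing n r} {m : ℕ} (hp : p.IsHomogeneous m)
    (A : Fin r → Matrix (Fin n) (Fin n) ℂ) : evalAt (c • A) p = c ^ m * evalAt A p := by
  have h := eval_mul_of_isWeightedHomogeneous (powersHom ℂ c) hp fun x => A x.1 x.2.1 x.2.2
  simpa [evalAt_eq_eval, powersHom_apply] using h

theorem exists_conj_eq_isPrimitiveRoot_smul (hn : n ≠ 0) :
    ∃ (D : Matrix (Fin n) (Fin n) ℂ) (ζ : ℂ) (g : GL (Fin n) ℂ), IsPrimitiveRoot ζ n ∧ D.det ≠ 0 ∧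
      (g : Matrix (Fin n) (Fin n) ℂ) * D * ((g⁻¹ : GL (Fin n) ℂ) : Matrix (Fin n) (Fin n) ℂ) =
        ζ • D := by
  have : NeZero n := ⟨hn⟩
  obtain ⟨ξ, hξ⟩ : ∃ ξ : ℂ, IsPrimitiveRoot ξ n := ⟨_, Complex.isPrimitiveRoot_exp n hn⟩
  have hξ0 : ξ ≠ 0 := hξ.ne_zero hn
  let σ : Equiv.Perm (Fin n) := Equiv.addRight 1
  let g : GL (Fin n) ℂ :=
    ⟨Matrix.diagonal fun i => ξ ^ (i : ℕ), Matrix.diagonal fun i => (ξ ^ (i : ℕ))⁻¹,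
      by simp [hξ0], by simp [hξ0]⟩
  refine ⟨σ.permMatrix ℂ, ξ⁻¹, g, hξ.inv, ?_, ?_⟩
  · rw [Matrix.det_permutation]
    exact_mod_cast (Equiv.Perm.sign σ).ne_zero
  · change Matrix.diagonal (fun i : Fin n => ξ ^ (i : ℕ)) * σ.permMatrix ℂ *
      Matrix.diagonal (fun i : Fin n => (ξ ^ (i : ℕ))⁻¹) = _
    ext i j
    rw [Matrix.mul_diagonal, Matrix.diagonal_mul, Matrix.smul_apply, smul_eq_mul,
      Equiv.Perm.permMatrix, PEquiv.toMatrix_apply]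
    by_cases hij : j ∈ σ.toPEquiv i
    · have hj : j = i + 1 := by simpa [σ, eq_comm] using hij
      rw [if_pos hij, hj, Fin.val_add, ← pow_eq_pow_mod _ hξ.pow_eq_one, pow_add, Fin.val_one',
        ← pow_eq_pow_mod _ hξ.pow_eq_one, pow_one]
      field_simp
    · rw [if_neg hij]
      simp

theorem invEval_single_eq_zero {D : Matrix (Fin n) (Fin n) ℂ} {ζ : ℂ} {g : GL (Fin n) ℂ}
    (hζ : IsPrimitiveRoot ζ n)
    (hg : (g : Matrix (Fin n) (Fin n) ℂ) * D *
      ((g⁻¹ : GL (Fin n) ℂ) : Matrix (Fin n) (Fin n) ℂ) = ζ • D)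
    {m : ℕ} (hm : m ≠ 0) (hmn : m < n) {p : invGL n r} (hp : p ∈ invGrading n r m) (k : Fin r) :
    invEval (Pi.single k D) p = 0 := by
  have hconj : (fun j => (g : Matrix (Fin n) (Fin n) ℂ) *
      (Pi.single k D : Fin r → Matrix (Fin n) (Fin n) ℂ) j *
        ((g⁻¹ : GL (Fin n) ℂ) : Matrix (Fin n) (Fin n) ℂ)) = ζ • Pi.single k D := by
    funext j
    rcases eq_or_ne j k with rfl | hj
    · simpa using hg
    · simp [hj]
  have hp' := p.2 g (Pi.single k D)
  rw [hconj, evalAt_smul_of_isHomogeneous ζ (mem_invGrading.1 hp)] at hp'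
  by_contra hne
  exact hζ.pow_ne_one_of_pos_of_lt hm hmn (mul_right_cancel₀ hne (hp'.trans (one_mul _).symm))

theorem invEval_single_gradedProj_traceInv {w : List (Fin r)} (hw : traceInv n w ∉ powerTraces n r)
    (D : Matrix (Fin n) (Fin n) ℂ) (k : Fin r) :
    invEval (Pi.single k D) (GradedAlgebra.proj (invGrading n r) n (traceInv n w)) = 0 := by
  rcases eq_or_ne w.length n with hlen | hlen
  · have hmem : traceInv n w ∈ invGrading n r n := hlen ▸ traceInv_mem_invGrading w
    obtain ⟨j, hjw, hjk⟩ : ∃ j ∈ w, j ≠ k := by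
      by_contra! hall
      exact hw ⟨k, by rw [List.eq_replicate_iff.2 ⟨hlen, hall⟩]⟩
    have hzero : 0 ∈ w.map (Pi.single (M := fun _ => Matrix (Fin n) (Fin n) ℂ) k D) :=
      List.mem_map.2 ⟨j, hjw, Pi.single_eq_of_ne (M := fun _ => Matrix (Fin n) (Fin n) ℂ) hjk D⟩
    rw [gradedProj_eq_self_of_mem hmem, invEval_traceInv, List.prod_eq_zero hzero,
      Matrix.trace_zero]
  · rw [gradedProj_eq_zero_of_mem (traceInv_mem_invGrading w) hlen, map_zero]

theorem exists_dual_differential_invAugmentation (hn : n ≠ 0) :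
    ∃ D : Matrix (Fin n) (Fin n) ℂ, D.det ≠ 0 ∧ ∀ k : Fin r,
      ∃ φ : Module.Dual ℂ (RingHom.ker (invAugmentation n r)).Cotangent,
        ∀ p, φ (differential (invAugmentation n r) p) =
          invEval (Pi.single k D) (GradedAlgebra.proj (invGrading n r) n p) := by
  obtain ⟨D, ζ, g, hζ, hD, hg⟩ := exists_conj_eq_isPrimitiveRoot_smul hn
  exact ⟨D, hD, fun k => exists_dual_comp_differential (𝒜 := invGrading n r)
    isAugmentation_invAugmentation hn (ψ := invEval (Pi.single k D))
    fun i hi hin p hp => invEval_single_eq_zero hζ hg hi hin hp k⟩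

theorem linearIndependent_mkQ_differential_detInv (hn : n ≠ 0) {S : Set (invGL n r)}
    (hS : S ⊆ Set.range (traceInv n) \ powerTraces n r) :
    LinearIndependent ℂ
      ((Submodule.span ℂ (differential (invAugmentation n r) '' S)).mkQ ∘
        fun k : Fin r => differential (invAugmentation n r) (detInv n k)) := by
  obtain ⟨D, hD, hφ⟩ := exists_dual_differential_invAugmentation (r := r) hn
  choose φ hφ using hφ
  have hφdet (k j : Fin r) : φ k (differential (invAugmentation n r) (detInv n j)) =
      (Pi.single (M := fun _ => Matrix (Fin n) (Fin n) ℂ) k D j).det := by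
    rw [hφ, gradedProj_eq_self_of_mem (detInv_mem_invGrading j), invEval_detInv]
  refine linearIndependent_mkQ_of_dual (φ := φ) (fun k => ?_) (fun k => ?_) fun j k hjk => ?_
  · suffices hle : Submodule.span ℂ (differential (invAugmentation n r) '' S) ≤
        LinearMap.ker (φ k) from fun w hw => hle hw
    rw [Submodule.span_le]
    rintro _ ⟨s, hs, rfl⟩
    obtain ⟨⟨w, rfl⟩, hw⟩ := hS hs
    exact (hφ k _).trans (invEval_single_gradedProj_traceInv hw D k)
  · rwa [hφdet, Pi.single_eq_same]
  · have : NeZero n := ⟨hn⟩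
    rw [hφdet, Pi.single_eq_of_ne hjk, Matrix.det_zero]

end DualFunctionals

section SpecialLinear

theorem exists_eq_smul_specialLinear (hn : n ≠ 0) {A : Matrix (Fin n) (Fin n) ℂ} (hA : A.det ≠ 0) :
    ∃ (c : ℂ) (B : SL(n, ℂ)), A = c • (B : Matrix (Fin n) (Fin n) ℂ) := by
  obtain ⟨c, hc⟩ := IsAlgClosed.exists_pow_nat_eq A.det (Nat.pos_of_ne_zero hn)
  have hc0 : c ≠ 0 := fun h => hA (by rw [← hc, h, zero_pow hn])
  refine ⟨c, ⟨c⁻¹ • A, ?_⟩, (smul_inv_smul₀ hc0 A).symm⟩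
  rw [Matrix.det_smul, Fintype.card_fin, ← hc, inv_pow, inv_mul_cancel₀ (pow_ne_zero n hc0)]

theorem exists_specialLinear_conj_eq (hn : n ≠ 0) (g : GL (Fin n) ℂ) :
    ∃ h : SL(n, ℂ), ∀ A : SL(n, ℂ), (g : Matrix (Fin n) (Fin n) ℂ) * A *
      ((g⁻¹ : GL (Fin n) ℂ) : Matrix (Fin n) (Fin n) ℂ) =
        ((h * A * h⁻¹ : SL(n, ℂ)) : Matrix (Fin n) (Fin n) ℂ) := by
  obtain ⟨c, h, hg⟩ := exists_eq_smul_specialLinear hn g.det.ne_zero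
  refine ⟨h, fun A => ?_⟩
  rw [Units.mul_inv_eq_iff_eq_mul]
  change (g : Matrix (Fin n) (Fin n) ℂ) = _ at hg
  rw [hg, Matrix.smul_mul, Matrix.mul_smul, ← Matrix.SpecialLinearGroup.coe_mul,
    ← Matrix.SpecialLinearGroup.coe_mul, inv_mul_cancel_right]

theorem restrictSL_apply (p : PolyRing n r) (A : Fin r → SL(n, ℂ)) :
    restrictSL n r p A = evalAt (fun k => (A k : Matrix (Fin n) (Fin n) ℂ)) p :=
  rfl

theorem proj_detInv (k : Fin r) : proj n r (detInv n k) = 1 :=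
  Subtype.ext (funext fun A =>
    (restrictSL_apply (detInv n k : PolyRing n r) A).trans ((evalAt_det _ k).trans (A k).2))

theorem eq_zero_of_evalAt_eq_zero_of_det_ne_zero {p : PolyRing n r}
    (h : ∀ A : Fin r → Matrix (Fin n) (Fin n) ℂ, (∀ k, (A k).det ≠ 0) → evalAt A p = 0) :
    p = 0 := by
  have hdet : ∏ k, (genericMatrix n r k).det ≠ 0 := fun h0 => by
    simpa [evalAt_det] using congrArg (evalAt 1) h0
  refine (mul_eq_zero.1 (ext_evalAt fun A => ?_)).resolve_right hdet
  rw [map_mul, map_prod, map_zero]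
  by_cases hA : ∀ k, (A k).det ≠ 0
  · rw [h A hA, zero_mul]
  · push Not at hA
    obtain ⟨k, hk⟩ := hA
    rw [Finset.prod_eq_zero (Finset.mem_univ k) (by rw [evalAt_det, hk]), mul_zero]

end SpecialLinear

section Homogenization

/-- The component of multidegree `m`, where the multidegree of a monomial records its degree in the
entries of each generic matrix. -/
noncomputable abbrev multiComponent (m : Fin r → ℕ) : PolyRing n r →ₗ[ℂ] PolyRing n r :=
  weightedHomogeneousComponent (fun x => Pi.single x.1 1) m

theorem exists_sum_multiComponent_eq (p : PolyRing n r) :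
    ∃ N : Fin r → ℕ, ∑ m ∈ Finset.Iic N, multiComponent m p = p := by
  let ω : Fin r × Fin n × Fin n → Fin r → ℕ := fun x => Pi.single x.1 1
  refine ⟨p.support.sup (Finsupp.weight ω), ?_⟩
  conv_rhs => rw [← sum_weightedHomogeneousComponent ω p]
  refine (finsum_eq_sum_of_support_subset _ fun m hm => ?_).symm
  by_contra hmN
  refine hm (weightedHomogeneousComponent_eq_zero' m p fun d hd hdm => hmN ?_)
  rw [Finset.mem_coe, Finset.mem_Iic, ← hdm]
  exact Finset.le_sup hd

theorem evalAt_smul_multiComponent (c : Fin r → ℂ) (A : Fin r → Matrix (Fin n) (Fin n) ℂ)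
    (m : Fin r → ℕ) (p : PolyRing n r) :
    evalAt (fun k => c k • A k) (multiComponent m p) =
      (∏ k, c k ^ m k) * evalAt A (multiComponent m p) := by
  let χ : Multiplicative (Fin r → ℕ) →* ℂ :=
    { toFun := fun m => ∏ k, c k ^ m.toAdd k
      map_one' := by simp
      map_mul' := fun a b => by simp [pow_add, Finset.prod_mul_distrib] }
  have hχ (k : Fin r) : χ (Multiplicative.ofAdd (Pi.single k 1)) = c k := by
    change ∏ j, c j ^ (Pi.single k 1 : Fin r → ℕ) j = c k
    rw [Finset.prod_eq_single k (fun j _ hj => by simp [hj]) (by simp), Pi.single_eq_same, pow_one]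
  have h := eval_mul_of_isWeightedHomogeneous (w := fun x => Pi.single x.1 1) χ
    (weightedHomogeneousComponent_isWeightedHomogeneous m p) fun x => A x.1 x.2.1 x.2.2
  simp only [hχ] at h
  exact h

/-- The product of determinants that raises multidegree `m` to the multidegree with entries
`n * N k + m k % n`, for `m ≤ N`. -/
noncomputable def detPower (n : ℕ) {r : ℕ} (N m : Fin r → ℕ) : invGL n r :=
  ∏ k, detInv n k ^ (N k - m k / n)

theorem evalAt_detPower (A : Fin r → Matrix (Fin n) (Fin n) ℂ) (N m : Fin r → ℕ) :
    evalAt A (detPower n N m : PolyRing n r) = ∏ k, (A k).det ^ (N k - m k / n) := by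
  rw [← invEval_apply, detPower, map_prod]
  simp only [map_pow, invEval_detInv]

/-- Homogenization by determinants: components whose multidegrees `m ≤ N` are congruent modulo `n`
are brought to the same multidegree. -/
noncomputable def homogenize (N : Fin r → ℕ) : PolyRing n r →ₗ[ℂ] PolyRing n r :=
  ∑ m ∈ Finset.Iic N, LinearMap.mulRight ℂ (detPower n N m : PolyRing n r) ∘ₗ multiComponent m

theorem homogenize_apply (N : Fin r → ℕ) (p : PolyRing n r) :
    homogenize N p = ∑ m ∈ Finset.Iic N, multiComponent m p * (detPower n N m : PolyRing n r) :=
  LinearMap.sum_apply _ _ _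

theorem conjHom_homogenize (g : GL (Fin n) ℂ) (N : Fin r → ℕ) (p : PolyRing n r) :
    conjHom g (homogenize N p) = homogenize N (conjHom g p) := by
  simp only [homogenize_apply, map_sum, map_mul, mem_invGL_iff.1 (detPower n N _).2 g,
    conjHom_weightedHomogeneousComponent (fun k => Pi.single k 1)]

theorem restrictSL_homogenize {N : Fin r → ℕ} {p : PolyRing n r}
    (hN : ∑ m ∈ Finset.Iic N, multiComponent m p = p) :
    restrictSL n r (homogenize N p) = restrictSL n r p := by
  conv_rhs => rw [← hN]
  funext A
  rw [restrictSL_apply, restrictSL_apply]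
  simp only [homogenize_apply, map_sum, map_mul, evalAt_detPower,
    Matrix.SpecialLinearGroup.det_coe, one_pow, Finset.prod_const_one, mul_one]

theorem evalAt_smul_homogenize (c : Fin r → ℂ) (B : Fin r → SL(n, ℂ)) (N : Fin r → ℕ)
    (p : PolyRing n r) :
    evalAt (fun k => c k • (B k : Matrix (Fin n) (Fin n) ℂ)) (homogenize N p) =
      (∏ k, c k ^ (n * N k)) * ∑ m ∈ Finset.Iic N, (∏ k, c k ^ (m k % n)) *
        evalAt (fun k => (B k : Matrix (Fin n) (Fin n) ℂ)) (multiComponent m p) := by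
  rw [homogenize_apply, map_sum, Finset.mul_sum]
  refine Finset.sum_congr rfl fun m hm => ?_
  have hexp (k : Fin r) : m k + n * (N k - m k / n) = n * N k + m k % n := by
    have hle : m k / n ≤ N k := (Nat.div_le_self _ _).trans (Finset.mem_Iic.1 hm k)
    rw [Nat.mul_sub, ← Nat.add_sub_assoc (Nat.mul_le_mul_left n hle), Nat.sub_eq_iff_eq_add
      ((Nat.mul_le_mul_left n hle).trans (Nat.le_add_left _ _)), add_assoc, Nat.mod_add_div,
      add_comm]
  rw [map_mul, evalAt_smul_multiComponent, evalAt_detPower, mul_right_comm, ← mul_assoc]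
  simp only [Matrix.det_smul, Fintype.card_fin, Matrix.SpecialLinearGroup.det_coe, mul_one,
    ← Finset.prod_mul_distrib, ← pow_mul, ← pow_add, hexp]

theorem sum_prod_pow_mod_mul_evalAt_eq_zero (hn : n ≠ 0) {N : Fin r → ℕ} {p : PolyRing n r}
    (hN : ∑ m ∈ Finset.Iic N, multiComponent m p = p) (hp : restrictSL n r p = 0)
    (c : Fin r → ℂ) (B : Fin r → SL(n, ℂ)) :
    ∑ m ∈ Finset.Iic N, (∏ k, c k ^ (m k % n)) *
      evalAt (fun k => (B k : Matrix (Fin n) (Fin n) ℂ)) (multiComponent m p) = 0 := by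
  let Q : MvPolynomial (Fin r) ℂ := ∑ m ∈ Finset.Iic N,
    monomial (Finsupp.equivFunOnFinite.symm fun k => m k % n)
      (evalAt (fun k => (B k : Matrix (Fin n) (Fin n) ℂ)) (multiComponent m p))
  have heval (c : Fin r → ℂ) : eval c Q = ∑ m ∈ Finset.Iic N, (∏ k, c k ^ (m k % n)) *
      evalAt (fun k => (B k : Matrix (Fin n) (Fin n) ℂ)) (multiComponent m p) := by
    rw [map_sum]
    refine Finset.sum_congr rfl fun m _ => ?_
    rw [eval_monomial, Finsupp.prod_fintype _ _ fun _ => pow_zero _, mul_comm]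
    rfl
  suffices hQ : Q = 0 by rw [← heval, hQ, map_zero]
  refine eq_zero_of_eval_zero_at_prod_finset Q (fun _ => Polynomial.nthRootsFinset n 1)
    (fun k => ?_) fun ζ hζ => ?_
  · rw [(Complex.isPrimitiveRoot_exp n hn).card_nthRootsFinset,
      degreeOf_lt_iff (Nat.pos_of_ne_zero hn)]
    intro d hd
    obtain ⟨m, -, hm⟩ := Finset.mem_biUnion.1 (support_sum hd)
    rw [Finset.mem_singleton.1 (support_monomial_subset hm)]
    exact Nat.mod_lt _ (Nat.pos_of_ne_zero hn)
  · have hroot (k : Fin r) : ζ k ^ n = 1 :=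
      (Polynomial.mem_nthRootsFinset (Nat.pos_of_ne_zero hn) 1).1 (hζ k)
    have hζB : evalAt (fun k => ζ k • (B k : Matrix (Fin n) (Fin n) ℂ)) p = 0 :=
      congrFun hp fun k => ⟨ζ k • (B k : Matrix (Fin n) (Fin n) ℂ), by
        rw [Matrix.det_smul, Fintype.card_fin, hroot, (B k).2, one_mul]⟩
    rw [heval, ← hζB]
    conv_rhs => rw [← hN]
    simp only [map_sum, evalAt_smul_multiComponent, ← pow_eq_pow_mod _ (hroot _)]

theorem homogenize_eq_zero_of_restrictSL_eq_zero (hn : n ≠ 0) {N : Fin r → ℕ} {p : PolyRing n r}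
    (hN : ∑ m ∈ Finset.Iic N, multiComponent m p = p) (hp : restrictSL n r p = 0) :
    homogenize N p = 0 := by
  refine eq_zero_of_evalAt_eq_zero_of_det_ne_zero fun A hA => ?_
  choose c B hcB using fun k => exists_eq_smul_specialLinear hn (hA k)
  rw [funext hcB, evalAt_smul_homogenize, sum_prod_pow_mod_mul_evalAt_eq_zero hn hN hp, mul_zero]

end Homogenization

section Projection

theorem proj_surjective (hn : n ≠ 0) : Function.Surjective (proj n r) := by
  rintro ⟨f, ⟨p, hp⟩, hf⟩
  change restrictSL n r p = f at hp
  obtain ⟨N, hN⟩ := exists_sum_multiComponent_eq p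
  have hres : restrictSL n r (homogenize N p) = f := (restrictSL_homogenize hN).trans hp
  refine ⟨⟨homogenize N p, mem_invGL_iff.2 fun g => ?_⟩, Subtype.ext hres⟩
  rw [conjHom_homogenize, ← sub_eq_zero, ← map_sub]
  refine homogenize_eq_zero_of_restrictSL_eq_zero hn ?_ ?_
  · simp only [map_sub, Finset.sum_sub_distrib,
      ← conjHom_weightedHomogeneousComponent (fun k => Pi.single k 1), ← map_sum, hN]
  · obtain ⟨h, hconj⟩ := exists_specialLinear_conj_eq hn g
    rw [map_sub, hp, sub_eq_zero]
    funext A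
    simp only [restrictSL_apply, evalAt_conjHom, hconj]
    rw [← hf h A, ← hp, restrictSL_apply]

theorem ker_proj (hn : n ≠ 0) : RingHom.ker (proj n r) =
    Ideal.span ((fun t => t - 1) '' Set.range (detInv n)) := by
  set I := Ideal.span ((fun t : invGL n r => t - 1) '' Set.range (detInv n))
  refine le_antisymm (fun p hp => ?_) (Ideal.span_le.2 ?_)
  · obtain ⟨N, hN⟩ := exists_sum_multiComponent_eq (p : PolyRing n r)
    let c (m : Fin r → ℕ) : invGL n r := ⟨multiComponent m (p : PolyRing n r),
      weightedHomogeneousComponent_mem_invGL (fun k => Pi.single k 1) p.2 m⟩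
    have hsum : ∑ m ∈ Finset.Iic N, c m = p :=
      Subtype.ext ((AddSubmonoidClass.coe_finsetSum _ _).trans hN)
    have hhom : ∑ m ∈ Finset.Iic N, c m * detPower n N m = 0 :=
      Subtype.ext ((AddSubmonoidClass.coe_finsetSum _ _).trans ((homogenize_apply N _).symm.trans
        (homogenize_eq_zero_of_restrictSL_eq_zero hn hN (congrArg Subtype.val hp))))
    have hdet (k : Fin r) : Ideal.Quotient.mk I (detInv n k) = 1 :=
      Ideal.Quotient.eq.2 (Ideal.subset_span ⟨_, ⟨k, rfl⟩, rfl⟩)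
    have hpow (m : Fin r → ℕ) : Ideal.Quotient.mk I (detPower n N m) = 1 := by
      simp only [detPower, map_prod, map_pow, hdet, one_pow, Finset.prod_const_one]
    rw [← Ideal.Quotient.eq_zero_iff_mem, ← hsum, ← map_zero (Ideal.Quotient.mk I), ← hhom]
    simp only [map_sum, map_mul, hpow, mul_one]
  · rintro _ ⟨_, ⟨k, rfl⟩, rfl⟩
    rw [SetLike.mem_coe, RingHom.mem_ker, map_sub, proj_detInv, map_one, sub_self]

end Projection

section DetComplement

/-- Evaluation of a regular function on `SL(n, ℂ)^r` at the tuple of identity matrices. -/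
noncomputable def invSLEvalOne (n r : ℕ) : invSL n r →ₐ[ℂ] ℂ :=
  (Pi.evalAlgHom ℂ (fun _ : Fin r → SL(n, ℂ) => ℂ) 1).comp (invSL n r).val

theorem invSLEvalOne_comp_proj : (invSLEvalOne n r).comp (proj n r) = invEval 1 := by
  ext p
  change restrictSL n r (p : PolyRing n r) 1 = evalAt 1 (p : PolyRing n r)
  rw [restrictSL_apply]
  congr 2

/-- A set of homogeneous invariants that the determinants of the generic matrices complete to a
minimal generating set. -/
structure IsDetComplement (B : Set (invGL n r)) : Prop where
  isHomogeneousElem : ∀ b ∈ B, SetLike.IsHomogeneousElem (invGrading n r) b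
  disjoint : Disjoint (Set.range (detInv n)) B
  isMinimalGenerating : IsMinimalGenerating (Set.range (detInv n) ∪ B)

theorem linearIndependent_differential_detInv (hn : n ≠ 0) :
    LinearIndependent ℂ fun k : Fin r => differential (invAugmentation n r) (detInv n k) :=
  .of_comp _ (linearIndependent_mkQ_differential_detInv hn (Set.empty_subset _))

theorem detInv_injective (hn : n ≠ 0) : Function.Injective (detInv n (r := r)) :=
  .of_comp (f := differential (invAugmentation n r))
    (linearIndependent_differential_detInv hn).injective

theorem isHomogeneousElem_of_mem_range_detInv_union {B : Set (invGL n r)}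
    (hB : ∀ b ∈ B, SetLike.IsHomogeneousElem (invGrading n r) b) :
    ∀ b ∈ Set.range (detInv n) ∪ B, SetLike.IsHomogeneousElem (invGrading n r) b := by
  rintro _ (⟨k, rfl⟩ | hb)
  exacts [⟨n, detInv_mem_invGrading k⟩, hB _ hb]

namespace IsDetComplement

theorem of_linearIndepOn_differential {B : Set (invGL n r)}
    (hhom : ∀ b ∈ B, SetLike.IsHomogeneousElem (invGrading n r) b)
    (hdisj : Disjoint (Set.range (detInv n)) B)
    (hLI : LinearIndepOn ℂ (differential (invAugmentation n r)) (Set.range (detInv n) ∪ B))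
    (hspan : Submodule.span ℂ
      (differential (invAugmentation n r) '' (Set.range (detInv n) ∪ B)) = ⊤) :
    IsDetComplement B :=
  ⟨hhom, hdisj, isMinimalGenerating_of_linearIndepOn_differential hLI
    (adjoin_eq_top_of_span_differential_eq_top isAugmentation_invAugmentation
      (isHomogeneousElem_of_mem_range_detInv_union hhom) hspan)⟩

variable {B : Set (invGL n r)} (hB : IsDetComplement B)
include hB

theorem linearIndepOn_differential :
    LinearIndepOn ℂ (differential (invAugmentation n r)) (Set.range (detInv n) ∪ B) :=
  linearIndepOn_differential_of_minimal isAugmentation_invAugmentation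
    (isHomogeneousElem_of_mem_range_detInv_union hB.isHomogeneousElem) hB.isMinimalGenerating

theorem linearIndepOn_differential_one :
    LinearIndepOn ℂ (differential (invEval 1)) (Set.range (detInv n) ∪ B) := by
  rw [← invAugmentation_comp_translateInv]
  exact linearIndepOn_differential_comp_of_gradedProj (𝒜 := invGrading n r)
    isAugmentation_invAugmentation (fun m p hp j hj => gradedProj_translateInv hp hj)
    (isHomogeneousElem_of_mem_range_detInv_union hB.isHomogeneousElem)
    hB.linearIndepOn_differential

theorem linearIndepOn_differential_comp_proj (hn : n ≠ 0) :
    LinearIndepOn ℂ (differential (invSLEvalOne n r) ∘ₗ (proj n r).toLinearMap) B :=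
  linearIndepOn_differential_comp_of_union (proj_surjective hn) invSLEvalOne_comp_proj
    (ker_proj hn) hB.disjoint hB.linearIndepOn_differential_one

theorem linearIndepOn_differential_proj_image (hn : n ≠ 0) :
    LinearIndepOn ℂ (differential (invSLEvalOne n r)) (proj n r '' B) :=
  LinearIndepOn.image_of_comp _ _ (hB.linearIndepOn_differential_comp_proj hn)

theorem adjoin_proj_image_eq_top (hn : n ≠ 0) : Algebra.adjoin ℂ (proj n r '' B) = ⊤ := by
  have hgen : Algebra.adjoin ℂ (proj n r '' (Set.range (detInv n) ∪ B)) = ⊤ := by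
    rw [← AlgHom.map_adjoin, hB.isMinimalGenerating.prop, Algebra.map_top,
      (AlgHom.range_eq_top _).2 (proj_surjective hn)]
  rw [eq_top_iff, ← hgen]
  refine Algebra.adjoin_le ?_
  rintro _ ⟨b, ⟨k, rfl⟩ | hb, rfl⟩
  · rw [proj_detInv]
    exact one_mem _
  · exact Algebra.subset_adjoin ⟨b, hb, rfl⟩

theorem isMinimalGenerating_proj_image (hn : n ≠ 0) : IsMinimalGenerating (proj n r '' B) :=
  isMinimalGenerating_of_linearIndepOn_differential (hB.linearIndepOn_differential_proj_image hn)
    (hB.adjoin_proj_image_eq_top hn)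

theorem encard_proj_image (hn : n ≠ 0) :
    (proj n r '' B).encard = minNumGenerators (invSL n r) :=
  encard_eq_minNumGenerators (hB.linearIndepOn_differential_proj_image hn)
    (hB.adjoin_proj_image_eq_top hn)

theorem encard_proj_image_add (hn : n ≠ 0) :
    (proj n r '' B).encard + r = minNumGenerators (invGL n r) := by
  have hinj : Set.InjOn (proj n r) B := fun a ha b hb hab =>
    (hB.linearIndepOn_differential_comp_proj hn).injOn ha hb
      (congrArg (differential (invSLEvalOne n r)) hab)
  have hdet : (Set.range (detInv n (r := r))).encard = r := by
    rw [← Set.image_univ, (detInv_injective hn).encard_image, Set.encard_univ,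
      ENat.card_eq_coe_fintype_card, Fintype.card_fin]
  rw [← encard_eq_minNumGenerators hB.linearIndepOn_differential hB.isMinimalGenerating.prop,
    Set.encard_union_eq hB.disjoint, hdet, hinj.encard_image, add_comm]

end IsDetComplement

theorem exists_isDetComplement (hn : n ≠ 0) : ∃ B : Set (invGL n r), IsDetComplement B := by
  classical
  let H : Set (invGL n r) := {p | SetLike.IsHomogeneousElem (invGrading n r) p}
  have hdet : LinearIndepOn ℂ (differential (invAugmentation n r)) (Set.range (detInv n)) :=
    (linearIndepOn_range_iff (detInv_injective hn) _).2 (linearIndependent_differential_detInv hn)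
  have hsub : Set.range (detInv n) ⊆ H := by
    rintro _ ⟨k, rfl⟩
    exact ⟨n, detInv_mem_invGrading k⟩
  have hspanH : Submodule.span ℂ (differential (invAugmentation n r) '' H) = ⊤ := by
    refine span_differential_eq_top _ (eq_top_iff.2 fun p _ => ?_)
    rw [← DirectSum.sum_support_decompose (invGrading n r) p]
    exact sum_mem fun m _ => Algebra.subset_adjoin ⟨m, SetLike.coe_mem _⟩
  refine ⟨hdet.extend hsub \ Set.range (detInv n), .of_linearIndepOn_differential
    (fun b hb => hdet.extend_subset hsub hb.1) Set.disjoint_sdiff_right ?_ ?_⟩ <;>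
    rw [Set.union_sdiff_cancel (hdet.subset_extend hsub)]
  · exact hdet.linearIndepOn_extend hsub
  · rw [hdet.span_image_extend_eq_span_image hsub, hspanH]

end DetComplement

section TraceGenerators

variable {G : Set (invGL n r)} (hG : ∀ s ∈ G, ∃ w : List (Fin r), s = traceInv n w)
  (hmin : IsMinimalGenerating G)
include hG

theorem isHomogeneousElem_of_eq_traceInv {s : invGL n r} (hs : s ∈ G) :
    SetLike.IsHomogeneousElem (invGrading n r) s := by
  obtain ⟨w, rfl⟩ := hG s hs
  exact ⟨_, traceInv_mem_invGrading w⟩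

include hmin

theorem linearIndepOn_differential_of_traceInv :
    LinearIndepOn ℂ (differential (invAugmentation n r)) G :=
  linearIndepOn_differential_of_minimal isAugmentation_invAugmentation
    (fun _ => isHomogeneousElem_of_eq_traceInv hG) hmin

theorem isDetComplement_sdiff_powerTraces (hn : n ≠ 0) :
    IsDetComplement (G \ powerTraces n r) := by
  set d := differential (invAugmentation n r)
  have hdet := linearIndependent_mkQ_differential_detInv hn (S := G \ powerTraces n r)
    fun s hs => ⟨(hG s hs.1).imp fun _ => Eq.symm, hs.2⟩
  refine .of_linearIndepOn_differential (fun s hs => isHomogeneousElem_of_eq_traceInv hG hs.1)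
    ?_ ?_ ?_
  · rw [Set.disjoint_left]
    rintro _ ⟨k, rfl⟩ hk
    exact hdet.ne_zero k ((Submodule.Quotient.mk_eq_zero _).2 (Submodule.subset_span ⟨_, hk, rfl⟩))
  · rw [Set.union_comm]
    exact ((linearIndepOn_differential_of_traceInv hG hmin).mono Set.sdiff_subset).union_of_quotient
      ((linearIndepOn_range_iff (detInv_injective hn) _).2 hdet)
  · rw [Set.union_comm, Set.image_union, ← Set.range_comp]
    refine span_union_range_eq_top (T := d '' (G ∩ powerTraces n r)) ?_ ?_ hdet
    · rw [← Set.image_union, Set.union_comm, Set.inter_union_sdiff]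
      exact span_differential_eq_top _ hmin.prop
    · calc (d '' (G ∩ powerTraces n r)).encard
          ≤ (powerTraces n r).encard :=
            (Set.encard_image_le _ _).trans (Set.encard_le_encard Set.inter_subset_right)
        _ ≤ (Set.univ : Set (Fin r)).encard := by
            rw [powerTraces, ← Set.image_univ]
            exact Set.encard_image_le _ _
        _ = Fintype.card (Fin r) := by rw [Set.encard_univ, ENat.card_eq_coe_fintype_card]

end TraceGenerators

end TraceInv

theorem mainTheorem6 (n r : ℕ) (hn : 1 ≤ n) :
    (∀ G : Set (TraceInv.invGL n r),
      TraceInv.IsProcesiGenerators G → TraceInv.IsMinimalGenerating G →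
        TraceInv.IsMinimalGenerating
          (TraceInv.proj n r '' (G \ TraceInv.powerTraces n r)) ∧
        (TraceInv.proj n r '' (G \ TraceInv.powerTraces n r)).encard + (r : ℕ∞) = G.encard ∧
        G.encard = TraceInv.minNumGenerators (TraceInv.invGL n r) ∧
        (TraceInv.proj n r '' (G \ TraceInv.powerTraces n r)).encard =
          TraceInv.minNumGenerators (TraceInv.invSL n r)) ∧
    TraceInv.minNumGenerators (TraceInv.invSL n r) + (r : ℕ∞) =
      TraceInv.minNumGenerators (TraceInv.invGL n r) := by
  have hn' : n ≠ 0 := Nat.one_le_iff_ne_zero.1 hn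
  refine ⟨fun G hP hmin => ?_, ?_⟩
  · have hB := TraceInv.isDetComplement_sdiff_powerTraces hP.isTrace hmin hn'
    have hcard : G.encard = TraceInv.minNumGenerators (TraceInv.invGL n r) :=
      TraceInv.encard_eq_minNumGenerators
        (TraceInv.linearIndepOn_differential_of_traceInv hP.isTrace hmin) hmin.prop
    exact ⟨hB.isMinimalGenerating_proj_image hn', (hB.encard_proj_image_add hn').trans hcard.symm,
      hcard, hB.encard_proj_image hn'⟩
  · obtain ⟨B, hB⟩ := TraceInv.exists_isDetComplement (r := r) hn'
    rw [← hB.encard_proj_image hn', hB.encard_proj_image_add hn']
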